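/- **Setting.** Let $\mathbb S$ be a decorated surface: a compact oriented surface with boundary, with finitely many marked points on the boundary and finitely many punctures (which are removed); let $\mathcal T$ be an ideal triangulation of $\mathbb S$, with vertices at the marked points and punctures (two sides of one triangle may be glued together). Its external edges are the boundary intervals between adjacent marked points. Let $k$ be a field and let $V$ be the plane $k^2$. A decoration is a class of pairs $(v,\omega)$, with $v\in V$ a non-zero vector and $\omega$ a non-zero area form on $V$, modulo $(v,\omega)\sim(\lambda v,\lambda^{-2}\omega)$, $\lambda \in k^\times$. A point of $\mathcal P_{\mathbb S}$ is a $\mathrm{PGL}_2$-local system on $\mathbb S$ with a decoration in the fibre at each marked point and, near each puncture, a flat section of the associated local system of projective lines (a framing), such that for each boundary interval the vectors of the decorations at its two ends, transported to the middle of the interval, are not collinear. The distinguished point of a vertex of $\mathcal T$ is the line spanned by the decoration vector, respectively the framing. Put $$r(x_1,x_2,x_3,x_4)=\frac{\omega(\tilde x_1,\tilde x_2)\,\omega(\tilde x_3,\tilde x_4)}{\omega(\tilde x_2,\tilde x_3)\,\omega(\tilde x_1,\tilde x_4)}$$ for four lines $x_i$ in $V$ spanned by $\tilde x_i$; it is defined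 if $x_2\ne x_3$ and $x_1\neq x_4$. In the following formulas all data are transported to a common fibre inside the triangles in question. * For an internal edge $\mathrm E$, $X_{\mathrm E}=r(x_1,x_2,x_3,x_4)$, where $x_1,\dots,x_4$ are the distinguished points of the vertices, in counterclockwise order, of the quadrilateral with diagonal $\mathrm E$, the first one being an end of $\mathrm E$. * For an external edge $\mathrm F$ that goes from $m$ to $m'$ in the boundary orientation (surface on the left), with decorations $(v_m,\omega_m)$ and $(v_{m'},\omega_{m'})$, let $x_4$ be the distinguished point of the third vertex of the triangle on $\mathrm F$. Then $\mathrm B_{\mathrm F}=r(\langle v_m\rangle,\,p_{\mathrm F},\,\langle v_{m'}\rangle,\,x_4)$ with the pinning point $p_{\mathrm F}=\langle \omega_m(v_m,v_{m'})\,v_m+v_{m'}\rangle$, and $\mathrm K_{\mathrm F}=\bigl(\omega_m(v_m,v_{m'})\,\omega_{m'}(v_m,v_{m'})\bigr)^{-1}$. * For a marked point $v$ with decoration $(u,\omega)$, let $\mathrm F$ and $\mathrm F^+$ be the external edges which, in the boundary orientation, start and end at $v$, and let $u_-$, $u_+$ be the decoration vectors at the other ends of $\mathrm F$ and $\mathrm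 F^+$, transported to $v$ along $\mathrm F$ and $\mathrm F^+$. The potential at $v$ is $$W_v=\frac{\omega(u_-,u_+)}{\omega(u,u_-)\,\omega(u,u_+)} .$$ **Theorem.** Let $v$ be a marked point of $\mathbb S$ and let $\mathrm F,\mathrm E_1,\dots,\mathrm E_k,\mathrm F^+$ ($k\ge 0$) be the edges of $\mathcal T$ at $v$ in counterclockwise order, so that $\mathrm F$ and $\mathrm F^+$ are the external edges starting and ending at $v$ (an edge with both ends at $v$ occurs twice; in particular $\mathrm F$ and $\mathrm F^+$ may coincide). Then, as rational functions on $\mathcal P_{\mathbb S}$, $$\mathrm K_{\mathrm F^+}=\mathrm B_{\mathrm F}\,X_{\mathrm E_1}\cdots X_{\mathrm E_k}\,\mathrm B_{\mathrm F^+},$$ $$W_v=\mathrm B_{\mathrm F}+\mathrm B_{\mathrm F}X_{\mathrm E_1}+\mathrm B_{\mathrm F}X_{\mathrm E_1}X_{\mathrm E_2}+\dots+\mathrm B_{\mathrm F}X_{\mathrm E_1}\cdots X_{\mathrm E_k}.$$ More precisely, the first identity holds at every point of $\mathcal P_{\mathbb S}$ at which $\mathrm B_{\mathrm F},X_{\mathrm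 E_1},\dots,X_{\mathrm E_k},\mathrm B_{\mathrm F^+}$ are defined, and the second at every point at which $\mathrm B_{\mathrm F},X_{\mathrm E_1},\dots,X_{\mathrm E_k}$ are defined. -/

import Mathlib

open CategoryTheory Topology
open scoped unitInterval MatrixGroups LinearAlgebra.Projectivization

noncomputable section

namespace DecSurf

/-! ### Linear algebra of the plane: decorations, lines, cross-ratio -/

section Plane

variable {k : Type*} [Field k]

/-- The standard area form on `k²`; every non-zero area form is a unique unit multiple of it. -/
def det2 (u v : Fin 2 → k) : k := u 0 * v 1 - u 1 * v 0

theorem det2_smul_left (a : k) (u v : Fin 2 → k) : det2 (a • u) v = a * det2 u v := by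
  simp only [det2, Pi.smul_apply, smul_eq_mul]; ring

theorem det2_smul_right (a : k) (u v : Fin 2 → k) : det2 u (a • v) = a * det2 u v := by
  simp only [det2, Pi.smul_apply, smul_eq_mul]; ring

theorem det2_self (u : Fin 2 → k) : det2 u u = 0 := by
  simp only [det2]; ring

variable (k) in
/-- A pair `(v, ω)`: a non-zero vector `v` of `k²` and the non-zero area form `ω = area • det2`. -/
@[ext]
structure VecArea where
  vec : Fin 2 → k
  vec_ne : vec ≠ 0
  area : kˣ

/-- The area form of a pair. -/
def VecArea.form (d : VecArea k) (u v : Fin 2 → k) : k := d.area * det2 u v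

/-- `GL₂` acts by push-forward: `g (v, ω) = (g v, ω ∘ (g⁻¹ × g⁻¹))`. -/
instance : MulAction (GL (Fin 2) k) (VecArea k) where
  smul g d := ⟨g • d.vec, (smul_ne_zero_iff_ne g).2 d.vec_ne,
    d.area * (Matrix.GeneralLinearGroup.det g)⁻¹⟩
  one_smul d := VecArea.ext (one_smul _ d.vec)
    (show d.area * (Matrix.GeneralLinearGroup.det (1 : GL (Fin 2) k))⁻¹ = d.area by simp)
  mul_smul g h d := VecArea.ext (mul_smul g h d.vec)
    (show d.area * (Matrix.GeneralLinearGroup.det (g * h))⁻¹ =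
        d.area * (Matrix.GeneralLinearGroup.det h)⁻¹ * (Matrix.GeneralLinearGroup.det g)⁻¹ by
      rw [map_mul, mul_inv, mul_comm (Matrix.GeneralLinearGroup.det g)⁻¹, mul_assoc])

theorem VecArea.vec_smul (g : GL (Fin 2) k) (d : VecArea k) : (g • d).vec = g • d.vec := rfl

theorem VecArea.area_smul (g : GL (Fin 2) k) (d : VecArea k) :
    (g • d).area = d.area * (Matrix.GeneralLinearGroup.det g)⁻¹ := rfl

variable (k) in
/-- `(v, ω) ∼ (λ v, λ⁻² ω)` for non-zero scalars `λ`. -/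
def rescaling : Setoid (VecArea k) where
  r d e := ∃ l : kˣ, e.vec = (l : k) • d.vec ∧ e.area = (l ^ 2)⁻¹ * d.area
  iseqv :=
    { refl := fun d => ⟨1, by simp, by simp⟩
      symm := by
        rintro d e ⟨l, h1, h2⟩
        refine ⟨l⁻¹, ?_, ?_⟩
        · rw [h1, smul_smul]; simp
        · rw [h2]; simp
      trans := by
        rintro d e f ⟨l, h1, h2⟩ ⟨m, h3, h4⟩
        refine ⟨m * l, ?_, ?_⟩
        · rw [h3, h1, smul_smul]; simp
        · rw [h4, h2, mul_pow, mul_inv, mul_assoc] }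

variable (k) in
/-- The decorated flag variety `𝒜` of `PGL₂`: pairs `(v, ω)` modulo `(v, ω) ∼ (λ v, λ⁻² ω)`. -/
def DecFlag : Type _ := Quotient (rescaling k)

/-- The class of a pair. -/
def DecFlag.mk (d : VecArea k) : DecFlag k := Quotient.mk (rescaling k) d

instance : MulAction (GL (Fin 2) k) (DecFlag k) where
  smul g := Quotient.map (fun d => g • d) (by
    rintro d e ⟨l, h1, h2⟩
    refine ⟨l, ?_, ?_⟩
    · rw [VecArea.vec_smul, VecArea.vec_smul, h1, smul_comm]
    · rw [VecArea.area_smul, VecArea.area_smul, h2, mul_assoc])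
  one_smul a := by
    induction a using Quotient.inductionOn with
    | h d => exact congrArg DecFlag.mk (one_smul (GL (Fin 2) k) d)
  mul_smul g h a := by
    induction a using Quotient.inductionOn with
    | h d => exact congrArg DecFlag.mk (mul_smul g h d)

/-- The scalar matrices act trivially, so `PGL₂` acts on `𝒜`. -/
instance : MulAction PGL(2, k) (DecFlag k) :=
  Matrix.ProjGenLinGroup.mulActionOfGL fun u a => by
    induction a using Quotient.inductionOn with
    | h d =>
      refine Quotient.sound (s := rescaling k) ⟨u⁻¹, ?_, ?_⟩
      · rw [VecArea.vec_smul]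
        funext i
        simp [Units.smul_def]
      · rw [VecArea.area_smul]
        have : Matrix.GeneralLinearGroup.det (Matrix.GeneralLinearGroup.scalar (Fin 2) u) =
            u ^ 2 := by
          ext; simp
        rw [this, inv_pow, inv_inv, mul_comm d.area, mul_inv_cancel_left]

/-- The line spanned by the vector of a decoration. -/
def DecFlag.line : DecFlag k → ℙ k (Fin 2 → k) :=
  Quotient.lift (fun d : VecArea k => Projectivization.mk k d.vec d.vec_ne) (by
    rintro d e ⟨l, h1, -⟩
    rw [Projectivization.mk_eq_mk_iff']
    exact ⟨((l⁻¹ : kˣ) : k), by rw [h1, smul_smul]; simp⟩)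

/-- The canonical function `Δ((v₁, ω₁), (v₂, ω₂)) = ω₁(v₁, v₂) ω₂(v₁, v₂)` on `𝒜 × 𝒜`. -/
def DecFlag.Delta : DecFlag k → DecFlag k → k :=
  Quotient.lift₂ (fun d e : VecArea k => d.form d.vec e.vec * e.form d.vec e.vec) (by
    rintro d e d' e' ⟨l, h1, h2⟩ ⟨m, h3, h4⟩
    have hl := l.ne_zero
    have hm := m.ne_zero
    simp only [VecArea.form, h1, h2, h3, h4, det2_smul_left, det2_smul_right, Units.val_mul,
      Units.val_inv_eq_inv_val, Units.val_pow_eq_pow_val]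
    field_simp)

theorem pinning_aux (d e : VecArea k) : d.form d.vec e.vec • d.vec + e.vec ≠ 0 := by
  intro h
  have h1 : det2 d.vec (d.form d.vec e.vec • d.vec + e.vec) = det2 d.vec e.vec := by
    simp only [det2, Pi.add_apply, Pi.smul_apply, smul_eq_mul]; ring
  have h2 : det2 d.vec e.vec = 0 := by
    rw [← h1, h]; simp [det2]
  apply e.vec_ne
  simpa [VecArea.form, h2] using h

/-- The pinning point of the ordered pair of decorations `(v, ω)`, `(v', ω')`: the line spanned by
`ω(v, v') v + v'`. If `v`, `v'` are not collinear it is the line of `v + v''`, where `v''` is the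
multiple of `v'` with `ω(v, v'') = 1`. -/
def DecFlag.pinning : DecFlag k → DecFlag k → ℙ k (Fin 2 → k) :=
  Quotient.lift₂
    (fun d e : VecArea k =>
      Projectivization.mk k (d.form d.vec e.vec • d.vec + e.vec) (pinning_aux d e)) (by
    rintro d e d' e' ⟨l, h1, h2⟩ ⟨m, h3, h4⟩
    rw [Projectivization.mk_eq_mk_iff']
    refine ⟨((m⁻¹ : kˣ) : k), ?_⟩
    have hl := l.ne_zero
    have hm := m.ne_zero
    funext i
    simp only [VecArea.form, h1, h2, h3, det2_smul_left, det2_smul_right, Units.val_mul,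
      Units.val_inv_eq_inv_val, Units.val_pow_eq_pow_val, Pi.add_apply, Pi.smul_apply, smul_eq_mul]
    field_simp)

/-- The cross-ratio `r(x₁, x₂, x₃, x₄) = ω(x̃₁, x̃₂) ω(x̃₃, x̃₄) / (ω(x̃₂, x̃₃) ω(x̃₁, x̃₄))`, where
`x̃ᵢ` is any non-zero vector on the line `xᵢ` (see `crossRatio_mk`). -/
def crossRatio (x₁ x₂ x₃ x₄ : ℙ k (Fin 2 → k)) : k :=
  (det2 x₁.rep x₂.rep * det2 x₃.rep x₄.rep) / (det2 x₂.rep x₃.rep * det2 x₁.rep x₄.rep)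

/-- The cross-ratio `r(x₁, x₂, x₃, x₄)` is defined (its denominator does not vanish). -/
def CrossRatioDefined (x₁ x₂ x₃ x₄ : ℙ k (Fin 2 → k)) : Prop := x₂ ≠ x₃ ∧ x₁ ≠ x₄

theorem crossRatio_mk {u₁ u₂ u₃ u₄ : Fin 2 → k} (h₁ : u₁ ≠ 0) (h₂ : u₂ ≠ 0) (h₃ : u₃ ≠ 0)
    (h₄ : u₄ ≠ 0) :
    crossRatio (Projectivization.mk k u₁ h₁) (Projectivization.mk k u₂ h₂)
      (Projectivization.mk k u₃ h₃) (Projectivization.mk k u₄ h₄) =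
      (det2 u₁ u₂ * det2 u₃ u₄) / (det2 u₂ u₃ * det2 u₁ u₄) := by
  obtain ⟨a, ha⟩ := Projectivization.exists_smul_eq_mk_rep k u₁ h₁
  obtain ⟨b, hb⟩ := Projectivization.exists_smul_eq_mk_rep k u₂ h₂
  obtain ⟨c, hc⟩ := Projectivization.exists_smul_eq_mk_rep k u₃ h₃
  obtain ⟨d, hd⟩ := Projectivization.exists_smul_eq_mk_rep k u₄ h₄
  rw [crossRatio, ← ha, ← hb, ← hc, ← hd]
  simp only [Units.smul_def, det2_smul_left, det2_smul_right]
  have e1 : (b : k) * ((a : k) * det2 u₁ u₂) * ((d : k) * ((c : k) * det2 u₃ u₄)) =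
    ((a : k) * b * c * d) * (det2 u₁ u₂ * det2 u₃ u₄) := by ring
  have e2 : (c : k) * ((b : k) * det2 u₂ u₃) * ((d : k) * ((a : k) * det2 u₁ u₄)) =
    ((a : k) * b * c * d) * (det2 u₂ u₃ * det2 u₁ u₄) := by ring
  rw [e1, e2]
  rw [mul_div_mul_left]
  simp

/-- The potential `ω(v₋, v₊) / (ω(v, v₋) ω(v, v₊))` of a decoration `(v, ω)` and the lines spanned
by `v₋` and `v₊`; it does not depend on the choice of `v₋`, `v₊` on their lines, nor on the
representative `(v, ω)`. -/
def DecFlag.potential (a : DecFlag k) (x y : ℙ k (Fin 2 → k)) : k :=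
  Quotient.lift
    (fun d : VecArea k => d.form x.rep y.rep / (d.form d.vec x.rep * d.form d.vec y.rep)) (by
      rintro d e ⟨l, h1, h2⟩
      have hl := l.ne_zero
      have ha := d.area.ne_zero
      simp only [VecArea.form, h1, h2, det2_smul_left, Units.val_mul,
        Units.val_inv_eq_inv_val, Units.val_pow_eq_pow_val]
      by_cases hx : det2 d.vec x.rep = 0
      · simp [hx]
      by_cases hy : det2 d.vec y.rep = 0
      · simp [hy]
      field_simp) a

theorem DecFlag.potential_mk (d : VecArea k) {u v : Fin 2 → k} (hu : u ≠ 0) (hv : v ≠ 0) :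
    (DecFlag.mk d).potential (Projectivization.mk k u hu) (Projectivization.mk k v hv) =
      d.form u v / (d.form d.vec u * d.form d.vec v) := by
  obtain ⟨a, ha⟩ := Projectivization.exists_smul_eq_mk_rep k u hu
  obtain ⟨b, hb⟩ := Projectivization.exists_smul_eq_mk_rep k v hv
  have h0 := a.ne_zero
  have h1 := b.ne_zero
  change d.form _ _ / (d.form _ _ * d.form _ _) = _
  rw [← ha, ← hb]
  simp only [VecArea.form, Units.smul_def, det2_smul_left, det2_smul_right]
  rw [← mul_div_mul_left (d.area * det2 u v) _ (mul_ne_zero h0 h1)]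
  congr 1 <;> ring

end Plane

/-! ### Ideal triangulations of decorated surfaces -/

/-- The standard closed triangle. Its vertices `0, 1, 2` are in counterclockwise order. -/
abbrev Triangle : Type := stdSimplex ℝ (Fin 3)

/-- The `i`-th vertex of the triangle. -/
abbrev vtx (i : Fin 3) : Triangle := stdSimplex.vertex i

/-- The point `(1 - s) x + s y` of the triangle. -/
def seg (x y : Triangle) (s : I) : Triangle :=
  ⟨AffineMap.lineMap (x : Fin 3 → ℝ) (y : Fin 3 → ℝ) (s : ℝ),
    (convex_stdSimplex ℝ (Fin 3)).lineMap_mem x.2 y.2 s.2⟩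

theorem seg_zero (x y : Triangle) : seg x y 0 = x :=
  Subtype.ext (by simp [seg]; rfl)

theorem seg_one (x y : Triangle) : seg x y 1 = y :=
  Subtype.ext (by simp [seg]; rfl)

theorem continuous_seg (x y : Triangle) : Continuous (seg x y) :=
  Continuous.subtype_mk (AffineMap.lineMap_continuous.comp continuous_subtype_val) _

theorem seg_apply (x y : Triangle) (s : I) (i : Fin 3) :
    (seg x y s).1 i = (1 - (s : ℝ)) * x.1 i + (s : ℝ) * y.1 i := by
  simp [seg, AffineMap.lineMap_apply_module]
  rfl

/-- If a segment in the triangle passes through a vertex, then an end of it is that vertex. -/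
theorem seg_eq_vtx {x y : Triangle} {s : I} {i : Fin 3} (h : seg x y s = vtx i) :
    x = vtx i ∨ y = vtx i := by
  have key : ∀ z : Triangle, z.1 i = 1 → z = vtx i := by
    intro z hz
    have hs : z.1 0 + z.1 1 + z.1 2 = 1 := by
      have := z.2.2
      rwa [Fin.sum_univ_three] at this
    have h0 := z.2.1 0
    have h1 := z.2.1 1
    have h2 := z.2.1 2
    apply Subtype.ext
    funext j
    fin_cases i <;> fin_cases j <;> simp_all <;> linarith
  have hx1 : x.1 i ≤ 1 := stdSimplex.le_one x i
  have hy1 : y.1 i ≤ 1 := stdSimplex.le_one y i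
  have hi : (1 - (s : ℝ)) * x.1 i + (s : ℝ) * y.1 i = 1 := by
    rw [← seg_apply, h]; simp
  by_cases hx : x.1 i = 1
  · exact Or.inl (key x hx)
  · right
    apply key
    have hlt : x.1 i < 1 := lt_of_le_of_ne hx1 hx
    have hs0 := s.2.1
    have hs1 := s.2.2
    have hs : (s : ℝ) = 1 := by
      by_contra hne
      have : (s : ℝ) < 1 := lt_of_le_of_ne hs1 hne
      nlinarith [mul_pos (sub_pos.2 this) (sub_pos.2 hlt), mul_nonneg hs0 (sub_nonneg.2 hy1)]
    rw [hs] at hi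
    linarith

/-- The elementary identifications of a gluing of triangles. A pair `c = (t, i)` names the side of
the triangle `t` from its vertex `i` to its vertex `i + 1`; if `glue c ≠ c`, the sides `c` and
`glue c` are identified affinely, reversing the orientation. -/
def GlueRel {Tri : Type} (glue : Tri × Fin 3 → Tri × Fin 3) (p q : Σ _ : Tri, Triangle) : Prop :=
  ∃ (c : Tri × Fin 3) (s : I), glue c ≠ c ∧
    p = ⟨c.1, seg (vtx c.2) (vtx (c.2 + 1)) s⟩ ∧
    q = ⟨(glue c).1, seg (vtx ((glue c).2 + 1)) (vtx (glue c).2) s⟩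

/-- An ideal triangulation of a decorated surface. `S` is the compact surface in which the
punctures are filled in by points, `M` is the set of marked points and `P` is the set of punctures;
the decorated surface itself is `S \ P`, oriented so that the charts of the triangles preserve the
orientation. The triangulation presents `S` as the quotient of finitely many oriented triangles by
an orientation reversing identification of some pairs of their sides; the sides that are not
identified with another side (`glue c = c`) are the external edges and form the boundary. Two sides
of one triangle may be identified with each other. The vertices are the marked points, which lie on
the boundary, and the punctures, which do not. -/
structure IdealTriangulation {S : Type*} [TopologicalSpace S] (M P : Set S) where
  /-- the triangles -/
  Tri : Type
  finite_tri : Finite Tri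
  /-- the identification of the sides -/
  glue : Tri × Fin 3 → Tri × Fin 3
  glue_involutive : Function.Involutive glue
  /-- the characteristic maps of the triangles -/
  chart : Tri → Triangle → S
  isQuotientMap : IsQuotientMap (fun p : (Σ _ : Tri, Triangle) => chart p.1 p.2)
  chart_eq_iff : ∀ p q : (Σ _ : Tri, Triangle),
    chart p.1 p.2 = chart q.1 q.2 ↔ Relation.EqvGen (GlueRel glue) p q
  mem_vertices_iff : ∀ t x, chart t x ∈ M ∪ P ↔ ∃ i, x = vtx i
  mem_marked_iff : ∀ m, m ∈ M ↔ ∃ c, glue c = c ∧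
    (m = chart c.1 (vtx c.2) ∨ m = chart c.1 (vtx (c.2 + 1)))
  disjoint : Disjoint M P

namespace IdealTriangulation

variable {S : Type*} [TopologicalSpace S] {M P : Set S} (T : IdealTriangulation M P)

/-- A pair `(t, i)`: the side of `t` from its vertex `i` to its vertex `i + 1`, oriented so that `t`
is on its left; also the corner of `t` at the vertex `i`. -/
abbrev Side : Type := T.Tri × Fin 3

/-- The external edges of the triangulation (boundary intervals of the surface), with the boundary
orientation, for which the surface is on the left. -/
abbrev External : Type := {c : T.Side // T.glue c = c}

/-- The starting point of a side. -/
def src (c : T.Side) : S := T.chart c.1 (vtx c.2)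

/-- The end point of a side. -/
def tgt (c : T.Side) : S := T.chart c.1 (vtx (c.2 + 1))

/-- The side that follows `c` in the boundary of its triangle. -/
def nextSide (c : T.Side) : T.Side := (c.1, c.2 + 1)

/-- The side that precedes `c` in the boundary of its triangle; it ends where `c` starts. -/
def prevSide (c : T.Side) : T.Side := (c.1, c.2 + 2)

/-- The middle point of a side. -/
def mid (c : T.Side) : Triangle :=
  seg (vtx c.2) (vtx (c.2 + 1)) ⟨1 / 2, by norm_num, by norm_num⟩

theorem continuous_chart (t : T.Tri) : Continuous (T.chart t) :=
  T.isQuotientMap.continuous.comp (@continuous_sigmaMk _ (fun _ : T.Tri => Triangle) _ t)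

theorem src_mem (F : T.External) : T.src F.1 ∈ M :=
  (T.mem_marked_iff _).2 ⟨F.1, F.2, Or.inl rfl⟩

theorem tgt_mem (F : T.External) : T.tgt F.1 ∈ M :=
  (T.mem_marked_iff _).2 ⟨F.1, F.2, Or.inr rfl⟩

theorem src_mem_puncture {c : T.Side} (h : T.src c ∉ M) : T.src c ∈ P :=
  ((T.mem_vertices_iff c.1 (vtx c.2)).2 ⟨c.2, rfl⟩).resolve_left h

theorem seg_notMem {t : T.Tri} {x y : Triangle} (hx : T.chart t x ∉ P) (hy : T.chart t y ∉ P)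
    (s : I) : T.chart t (seg x y s) ∉ P := by
  intro h
  obtain ⟨i, hi⟩ := (T.mem_vertices_iff t _).1 (Or.inr h)
  rcases seg_eq_vtx hi with h' | h'
  · exact hx (by rwa [h', ← hi])
  · exact hy (by rwa [h', ← hi])

/-- The image in `S \ P` of the straight path from `x` to `y` in the triangle `t`. -/
def path (t : T.Tri) (x y : Triangle) (hx : T.chart t x ∉ P) (hy : T.chart t y ∉ P) :
    Path (⟨T.chart t x, hx⟩ : ↥Pᶜ) ⟨T.chart t y, hy⟩ where
  toFun s := ⟨T.chart t (seg x y s), T.seg_notMem hx hy s⟩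
  continuous_toFun :=
    Continuous.subtype_mk ((T.continuous_chart t).comp (continuous_seg x y)) _
  source' := Subtype.ext (by simp only [seg_zero])
  target' := Subtype.ext (by simp only [seg_one])

/-- The edges of the triangulation at the vertex `v`, a marked point, in counterclockwise order:
`corner 0, …, corner k` are the successive corners of triangles at `v`. The side `corner 0` starts
at `v` and is the external edge `F`; the triangle of `corner j` has the sides `corner j`, starting
at `v`, and `prevSide (corner j)`, ending at `v`, which comes next in the counterclockwise order.
For `j < k` the latter is the internal edge `E_{j+1}`, which across it is the side
`corner (j + 1)`; for `j = k` it is the external edge `F⁺`. -/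
structure Fan (v : S) where
  k : ℕ
  corner : Fin (k + 1) → T.Side
  src_first : T.src (corner 0) = v
  first_external : T.glue (corner 0) = corner 0
  internal : ∀ j : Fin k, T.glue (T.prevSide (corner j.castSucc)) ≠ T.prevSide (corner j.castSucc)
  succ : ∀ j : Fin k, corner j.succ = T.glue (T.prevSide (corner j.castSucc))
  last_external : T.glue (T.prevSide (corner (Fin.last k))) = T.prevSide (corner (Fin.last k))

namespace Fan

variable {T} {v : S} (f : T.Fan v)

/-- The external edge `F` starting at `v`. -/
def F : T.External := ⟨f.corner 0, f.first_external⟩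

/-- The internal edges `E_1, …, E_k` at `v` (indexed by `0, …, k - 1`), as sides starting at `v`. -/
def E (j : Fin f.k) : T.Side := f.corner j.succ

/-- The external edge `F⁺` ending at `v`. -/
def Fplus : T.External := ⟨T.prevSide (f.corner (Fin.last f.k)), f.last_external⟩

theorem src_corner (j : Fin (f.k + 1)) : T.src (f.corner j) = v := by
  induction j using Fin.induction with
  | zero => exact f.src_first
  | succ j ih =>
    refine Eq.trans ?_ ih
    rw [f.succ j]
    set c := T.prevSide (f.corner j.castSucc) with hc
    have h := (T.chart_eq_iff ⟨c.1, seg (vtx c.2) (vtx (c.2 + 1)) 1⟩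
      ⟨(T.glue c).1, seg (vtx ((T.glue c).2 + 1)) (vtx (T.glue c).2) 1⟩).2
      (Relation.EqvGen.rel _ _ ⟨c, 1, f.internal j, rfl, rfl⟩)
    simp only [seg_one] at h
    have h3 : (f.corner j.castSucc).2 + 2 + 1 = (f.corner j.castSucc).2 := by
      generalize (f.corner j.castSucc).2 = i
      fin_cases i <;> rfl
    simp only [src]
    rw [← h, hc]
    simp only [prevSide, h3]

theorem src_F : T.src f.F.1 = v := f.src_first

theorem src_E (j : Fin f.k) : T.src (f.E j) = v := f.src_corner _

theorem tgt_Fplus : T.tgt f.Fplus.1 = v := by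
  refine Eq.trans ?_ (f.src_corner (Fin.last f.k))
  have h3 : (f.corner (Fin.last f.k)).2 + 2 + 1 = (f.corner (Fin.last f.k)).2 := by
    generalize (f.corner (Fin.last f.k)).2 = i
    fin_cases i <;> rfl
  simp only [tgt, src, Fplus, prevSide, h3]

end Fan

end IdealTriangulation

/-! ### The moduli space and its functions -/

/-- The parallel transport of a local system, given as a functor on the fundamental groupoid, along a
path from `x` to `y`: an element of the group, which maps the fibre at `x` to the fibre at `y`. -/
def holonomy {G : Type*} [Group G] {X : Type*} [TopologicalSpace X]
    (loc : FundamentalGroupoid X ⥤ SingleObj G) {x y : X} (γ : Path x y) : G :=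
  loc.map (FundamentalGroupoid.fromPath (Path.Homotopic.Quotient.mk γ))

/-- A triple: a `PGL₂`-local system on `S \ P`, a decoration at each marked point and a framing at
each puncture. The local system is given by its parallel transport, with the fibres of the
associated bundles trivialised at each point separately. A flat section of the local system of
decorated flags near a marked point is the same as its value at this point. A framing is a flat
section of the local system of projective lines on a punctured neighbourhood of the puncture. -/
structure FramedSystem (k : Type*) [Field k] {S : Type*} [TopologicalSpace S] (M P : Set S) where
  /-- the local system -/
  loc : FundamentalGroupoid ↥Pᶜ ⥤ SingleObj PGL(2, k)
  /-- the decorations -/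
  decoration : M → DecFlag k
  /-- the framings; only the values near the puncture are relevant -/
  framing : P → ↥Pᶜ → ℙ k (Fin 2 → k)
  framing_flat : ∀ p : P, ∃ U ∈ 𝓝 (p : S), ∀ (x y : ↥Pᶜ) (γ : Path x y), (∀ s, (γ s : S) ∈ U) →
    framing p y = holonomy loc γ • framing p x

namespace FramedSystem

variable {k : Type*} [Field k] {S : Type*} [TopologicalSpace S] {M P : Set S}
  (L : FramedSystem k M P) (T : IdealTriangulation M P)

/-- Parallel transport along a path from the fibre at its source to the fibre at its target. -/
def hol {x y : ↥Pᶜ} (γ : Path x y) : PGL(2, k) := holonomy L.loc γ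

open Classical in
/-- Parallel transport from the point `x` to the point `y` inside the triangle `t`. It is used only
when `x` and `y` are not punctures. -/
def transport (t : T.Tri) (x y : Triangle) : PGL(2, k) :=
  if h : T.chart t x ∉ P ∧ T.chart t y ∉ P then L.hol (T.path t x y h.1 h.2) else 1

/-- For a side `c` of a triangle starting at a marked point: the decoration at that point,
transported inside the triangle to its point `y`. -/
def decAt (c : T.Side) (h : T.src c ∈ M) (y : Triangle) : DecFlag k :=
  L.transport T c.1 (vtx c.2) y • L.decoration ⟨T.src c, h⟩

/-- For a side `c` of a triangle starting at a puncture: the framing at the puncture, transported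
inside the triangle to its point `y`. It is the common value, for all small `s > 0`, of the
transport to `y` of the framing at the point `(1 - s) x + s y` near the corner `x`. -/
def framingAt (c : T.Side) (h : T.src c ∈ P) (y : Triangle) : ℙ k (Fin 2 → k) :=
  Classical.epsilon fun l => ∀ᶠ s in 𝓝[>] (0 : I),
    ∃ hs : T.chart c.1 (seg (vtx c.2) y s) ∉ P,
      L.transport T c.1 (seg (vtx c.2) y s) y • L.framing ⟨T.src c, h⟩ ⟨_, hs⟩ = l

open Classical in
/-- For a side `c` of a triangle: the distinguished point (decoration point or framing point) of the
vertex at which `c` starts, transported inside the triangle to its point `y`. -/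
def lineAt (c : T.Side) (y : Triangle) : ℙ k (Fin 2 → k) :=
  if h : T.src c ∈ M then (L.decAt T c h y).line else L.framingAt T c (T.src_mem_puncture h) y

/-- The decoration at the start of an external edge, transported along this edge to its middle. -/
def decSrc (F : T.External) : DecFlag k := L.decAt T F.1 (T.src_mem F) (T.mid F.1)

/-- The decoration at the end of an external edge, transported along this edge to its middle. -/
def decTgt (F : T.External) : DecFlag k :=
  L.decAt T (T.nextSide F.1) (T.tgt_mem F) (T.mid F.1)

/-- Decorations at adjacent marked points are in generic position: transported to the middle of the
boundary interval, their vectors are not collinear. -/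
def IsGeneric : Prop := ∀ F : T.External, (L.decSrc T F).line ≠ (L.decTgt T F).line

/-- The four lines whose cross-ratio is `B_F`, in the fibre over the middle of `F`: the decoration
point at the start of `F`, the pinning point of `F`, the decoration point at the end of `F`, the
distinguished point of the third vertex of the triangle on `F`. -/
def quadB (F : T.External) (i : Fin 4) : ℙ k (Fin 2 → k) :=
  ![(L.decSrc T F).line, (L.decSrc T F).pinning (L.decTgt T F), (L.decTgt T F).line,
    L.lineAt T (T.prevSide F.1) (T.mid F.1)] i

/-- The boundary coordinate `B_F`. -/
def B (F : T.External) : k :=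
  crossRatio (L.quadB T F 0) (L.quadB T F 1) (L.quadB T F 2) (L.quadB T F 3)

/-- The boundary coordinate `B_F` is defined at this point of the moduli space. -/
def BDefined (F : T.External) : Prop :=
  CrossRatioDefined (L.quadB T F 0) (L.quadB T F 1) (L.quadB T F 2) (L.quadB T F 3)

/-- The four lines whose cross-ratio is `X_E` for the internal edge `E` given by the side `c`, in
the fibre over the middle of `E`: the distinguished points of the vertices of the quadrilateral with
the diagonal `E`, in counterclockwise order, beginning with the start of `c`; the second one is the
vertex of the triangle on the other side of `E`. -/
def quadX (c : T.Side) (i : Fin 4) : ℙ k (Fin 2 → k) :=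
  ![L.lineAt T c (T.mid c), L.lineAt T (T.prevSide (T.glue c)) (T.mid (T.glue c)),
    L.lineAt T (T.nextSide c) (T.mid c), L.lineAt T (T.prevSide c) (T.mid c)] i

/-- The coordinate `X_E` of the internal edge `E` given by the side `c`. -/
def X (c : T.Side) : k :=
  crossRatio (L.quadX T c 0) (L.quadX T c 1) (L.quadX T c 2) (L.quadX T c 3)

/-- The coordinate `X_E` is defined at this point of the moduli space. -/
def XDefined (c : T.Side) : Prop :=
  CrossRatioDefined (L.quadX T c 0) (L.quadX T c 1) (L.quadX T c 2) (L.quadX T c 3)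

/-- The function `K_F = (ω₁(v₁, v₂) ω₂(v₁, v₂))⁻¹` of an external edge `F`, where `(v₁, ω₁)` and
`(v₂, ω₂)` are the decorations at its ends. -/
def K (F : T.External) : k := ((L.decSrc T F).Delta (L.decTgt T F))⁻¹

/-- The potential `W_v` at a marked point `v`, where `F` and `F'` are the boundary intervals that
start and end at `v`: with `(v_m, ω)` the decoration at `v` and `v₋`, `v₊` the decoration vectors at
the other ends of `F` and `F'`, transported to `v` along `F` and `F'`, it is
`ω(v₋, v₊) / (ω(v_m, v₋) ω(v_m, v₊))`. -/
def W (v : M) (F F' : T.External) (_ : T.src F.1 = v) (_ : T.tgt F'.1 = v) : k :=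
  (L.decoration v).potential
    (L.decAt T (T.nextSide F.1) (T.tgt_mem F) (vtx F.1.2)).line
    (L.decAt T F'.1 (T.src_mem F') (vtx (F'.1.2 + 1))).line

end FramedSystem

end DecSurf

end

/-!
Everything is transported to the fibre at the marked point `v`. Let `a` be the decoration at `v`,
with vector `u` and area form `ω`, and let `x_0, …, x_{k+1}` be the distinguished points of the far
ends of the edges `F, E_1, …, E_k, F⁺`, transported to `v` along these edges (`farLine`). For two
lines spanned by `y` and `z` put `w(y, z) = ω(y, z) / (ω(u, y) ω(u, z))`, the potential of `a`. Then

* `B_F = w(x_0, x_1)`: the pinning point is chosen so that the cross-ratio collapses to the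
  potential (`crossRatio_pinning_eq_potential`);
* `X_{E_{j+1}} = r(u, x_j, x_{j+1}, x_{j+2})`, so multiplication by it carries `w(x_j, x_{j+1})` to
  `w(x_{j+1}, x_{j+2})` (`potential_mul_crossRatio`), and the partial products `B_F X_{E_1} ⋯ X_{E_j}`
  are the `w(x_j, x_{j+1})`;
* `w` is additive, `w(x, y) + w(y, z) = w(x, z)`, by the Plücker relation
  (`potential_add_potential`), so the sum of these products is `w(x_0, x_{k+1}) = W_v`;
* the last product `w(x_k, x_{k+1})` times `B_{F⁺}` is `K_{F⁺}` (`potential_mul_crossRatio_pinning`).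

The quantities involved are invariant under `PGL₂`, so they may be computed in any fibre. That they
can all be moved to `v` rests on two facts about parallel transport. Inside a triangle without its
corners at punctures, which is convex, it is independent of the path (`transport_mul`), and hence
the distinguished points of the triangle are compatible with it (`lineAt_eq_smul`); for a framing
this uses its flatness near the puncture. Across an edge, transport and distinguished points seen
from the two adjacent triangles agree (`transport_congr`, `lineAt_congr`).
-/

namespace DecSurf

/-! ### Decorations, cross-ratios and the potential -/

section Plane

variable {k : Type*} [Field k]

theorem det2_comm (u v : Fin 2 → k) : det2 v u = -det2 u v := by
  simp only [det2]; ring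

theorem det2_GL_smul (g : GL (Fin 2) k) (u v : Fin 2 → k) :
    det2 (g • u) (g • v) = (Matrix.GeneralLinearGroup.det g : k) * det2 u v := by
  simp only [det2, Units.smul_def, Matrix.smul_eq_mulVec, Matrix.mulVec, dotProduct,
    Fin.sum_univ_two, Matrix.GeneralLinearGroup.val_det_apply, Matrix.det_fin_two]
  ring

theorem det2_ne_zero_iff {u v : Fin 2 → k} (hu : u ≠ 0) (hv : v ≠ 0) :
    det2 u v ≠ 0 ↔ Projectivization.mk k u hu ≠ Projectivization.mk k v hv := by
  rw [not_iff_not, Projectivization.mk_eq_mk_iff']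
  constructor
  · intro h
    have h' : u 0 * v 1 = u 1 * v 0 := sub_eq_zero.1 h
    by_cases h0 : v 0 = 0
    · have h1 : v 1 ≠ 0 := fun h1 => hv (by ext i; fin_cases i <;> assumption)
      refine ⟨u 1 / v 1, ?_⟩
      ext i
      fin_cases i
      · have : u 0 = 0 := by simpa [h0, h1] using h'
        simp [h0, this]
      · simp [h1]
    · refine ⟨u 0 / v 0, ?_⟩
      ext i
      fin_cases i
      · simp [h0]
      · simp only [Fin.mk_one, Pi.smul_apply, smul_eq_mul]
        field_simp
        linear_combination h'
  · rintro ⟨a, rfl⟩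
    rw [det2_smul_left, det2_self, mul_zero]

theorem crossRatio_smul (g : PGL(2, k)) (x₁ x₂ x₃ x₄ : ℙ k (Fin 2 → k)) :
    crossRatio (g • x₁) (g • x₂) (g • x₃) (g • x₄) = crossRatio x₁ x₂ x₃ x₄ := by
  induction g using Matrix.ProjGenLinGroup.induction_on with | mk g =>
  induction x₁ using Projectivization.ind with | _ u₁ h₁ =>
  induction x₂ using Projectivization.ind with | _ u₂ h₂ =>
  induction x₃ using Projectivization.ind with | _ u₃ h₃ =>
  induction x₄ using Projectivization.ind with | _ u₄ h₄ =>
  simp only [Projectivization.PGL.mk_smul_mk, crossRatio_mk, det2_GL_smul]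
  have hg := (Matrix.GeneralLinearGroup.det g).ne_zero
  rw [mul_mul_mul_comm, mul_mul_mul_comm (_ : k) (det2 u₂ u₃),
    mul_div_mul_left _ _ (mul_ne_zero hg hg)]

theorem crossRatioDefined_smul (g : PGL(2, k)) (x₁ x₂ x₃ x₄ : ℙ k (Fin 2 → k)) :
    CrossRatioDefined (g • x₁) (g • x₂) (g • x₃) (g • x₄) ↔ CrossRatioDefined x₁ x₂ x₃ x₄ := by
  simp [CrossRatioDefined]

namespace DecFlag

theorem ind {motive : DecFlag k → Prop} (h : ∀ d, motive (mk d)) (a : DecFlag k) : motive a :=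
  Quotient.inductionOn a h

theorem line_smul (g : PGL(2, k)) (a : DecFlag k) : (g • a).line = g • a.line := by
  induction g using Matrix.ProjGenLinGroup.induction_on with | mk g =>
  induction a using DecFlag.ind with | _ d =>
  rfl

theorem line_mk (d : VecArea k) : (mk d).line = Projectivization.mk k d.vec d.vec_ne := rfl

theorem pinning_mk (d e : VecArea k) : (mk d).pinning (mk e) =
    Projectivization.mk k (d.form d.vec e.vec • d.vec + e.vec) (pinning_aux d e) := rfl

theorem Delta_mk (d e : VecArea k) :
    (mk d).Delta (mk e) = d.form d.vec e.vec * e.form d.vec e.vec := rfl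

theorem mk_smul_mk (g : GL (Fin 2) k) (d : VecArea k) :
    (.mk g : PGL(2, k)) • mk d = mk (g • d) := rfl

/-- The area form of `g • d` is the push-forward of the area form of `d`. -/
theorem form_smul (g : GL (Fin 2) k) (d : VecArea k) (u v : Fin 2 → k) :
    (g • d).form (g • u) (g • v) = d.form u v := by
  rw [VecArea.form, VecArea.area_smul, det2_GL_smul, VecArea.form, Units.val_mul, mul_assoc,
    Units.inv_mul_cancel_left]

theorem Delta_smul (g : PGL(2, k)) (a b : DecFlag k) : (g • a).Delta (g • b) = a.Delta b := by
  induction g using Matrix.ProjGenLinGroup.induction_on with | mk g =>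
  induction a using DecFlag.ind with | _ d =>
  induction b using DecFlag.ind with | _ e =>
  simp only [mk_smul_mk, Delta_mk, VecArea.vec_smul, form_smul]

theorem pinning_smul (g : PGL(2, k)) (a b : DecFlag k) :
    (g • a).pinning (g • b) = g • a.pinning b := by
  induction g using Matrix.ProjGenLinGroup.induction_on with | mk g =>
  induction a using DecFlag.ind with | _ d =>
  induction b using DecFlag.ind with | _ e =>
  simp only [mk_smul_mk, pinning_mk, VecArea.vec_smul, form_smul,
    Projectivization.PGL.mk_smul_mk, smul_add]
  congr 2
  exact smul_comm _ g _

/-- The cross-ratio defining `B` is a potential: the pinning point eliminates the decoration of the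
second flag, of which only the line remains. -/
theorem crossRatio_pinning_eq_potential (a b : DecFlag k) (y : ℙ k (Fin 2 → k))
    (hb : a.line ≠ b.line) (hy : a.line ≠ y) :
    crossRatio a.line (a.pinning b) b.line y = a.potential b.line y := by
  induction a using DecFlag.ind with | _ d =>
  induction b using DecFlag.ind with | _ e =>
  induction y using Projectivization.ind with | _ w hw =>
  rw [line_mk, line_mk, ← det2_ne_zero_iff] at hb
  rw [line_mk, ← det2_ne_zero_iff] at hy
  rw [pinning_mk, line_mk, line_mk, crossRatio_mk, potential_mk]
  have h1 : det2 d.vec (d.form d.vec e.vec • d.vec + e.vec) = det2 d.vec e.vec := by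
    simp only [det2, Pi.add_apply, Pi.smul_apply, smul_eq_mul]; ring
  have h2 : det2 (d.form d.vec e.vec • d.vec + e.vec) e.vec =
      d.form d.vec e.vec * det2 d.vec e.vec := by
    simp only [det2, Pi.add_apply, Pi.smul_apply, smul_eq_mul]; ring
  rw [h1, h2]
  have := d.area.ne_zero
  simp only [VecArea.form]
  field_simp

/-- Multiplication by the coordinate of an edge moves the potential to the next pair of edges. -/
theorem potential_mul_crossRatio (a : DecFlag k) (x y z : ℙ k (Fin 2 → k))
    (hx : a.line ≠ x) (hxy : x ≠ y) :
    a.potential x y * crossRatio a.line x y z = a.potential y z := by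
  induction a using DecFlag.ind with | _ d =>
  induction x using Projectivization.ind with | _ u hu =>
  induction y using Projectivization.ind with | _ v hv =>
  induction z using Projectivization.ind with | _ w hw =>
  rw [line_mk, ← det2_ne_zero_iff] at hx
  rw [← det2_ne_zero_iff] at hxy
  rw [line_mk, crossRatio_mk, potential_mk, potential_mk]
  have := d.area.ne_zero
  simp only [VecArea.form]
  field_simp

/-- The potential is additive in consecutive pairs of lines, by the Plücker relation. -/
theorem potential_add_potential (a : DecFlag k) (x y z : ℙ k (Fin 2 → k))
    (hx : a.line ≠ x) (hy : a.line ≠ y) (hz : a.line ≠ z) :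
    a.potential x y + a.potential y z = a.potential x z := by
  induction a using DecFlag.ind with | _ d =>
  induction x using Projectivization.ind with | _ u hu =>
  induction y using Projectivization.ind with | _ v hv =>
  induction z using Projectivization.ind with | _ w hw =>
  rw [line_mk, ← det2_ne_zero_iff] at hx hy hz
  rw [potential_mk, potential_mk, potential_mk]
  have := d.area.ne_zero
  simp only [VecArea.form]
  field_simp
  simp only [det2]
  ring

/-- The potential of the last two lines times the boundary coordinate of the last edge, whose
orientation has `a` as its second flag, depends only on the two flags. -/
theorem potential_mul_crossRatio_pinning (a b : DecFlag k) (x : ℙ k (Fin 2 → k))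
    (hb : a.line ≠ b.line) (hx : a.line ≠ x) (hbx : b.line ≠ x) :
    a.potential x b.line * crossRatio b.line (b.pinning a) a.line x = (b.Delta a)⁻¹ := by
  rw [crossRatio_pinning_eq_potential b a x hb.symm hbx]
  induction a using DecFlag.ind with | _ d =>
  induction b using DecFlag.ind with | _ e =>
  induction x using Projectivization.ind with | _ w hw =>
  rw [line_mk, line_mk, ← det2_ne_zero_iff] at hb
  rw [line_mk, ← det2_ne_zero_iff] at hx hbx
  rw [line_mk, line_mk, potential_mk, potential_mk, Delta_mk]
  have := d.area.ne_zero
  have := e.area.ne_zero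
  simp only [VecArea.form, det2_comm d.vec e.vec, det2_comm e.vec w]
  field_simp

end DecFlag

end Plane

/-! ### Parallel transport inside a triangle -/

theorem holonomy_trans {G : Type*} [Group G] {X : Type*} [TopologicalSpace X]
    (loc : FundamentalGroupoid X ⥤ SingleObj G) {x y z : X} (γ : Path x y) (δ : Path y z) :
    holonomy loc (γ.trans δ) = holonomy loc δ * holonomy loc γ := by
  rw [holonomy, Path.Homotopic.Quotient.mk_trans]
  exact loc.map_comp (FundamentalGroupoid.fromPath (Path.Homotopic.Quotient.mk γ))
    (FundamentalGroupoid.fromPath (Path.Homotopic.Quotient.mk δ))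

theorem holonomy_congr {G : Type*} [Group G] {X : Type*} [TopologicalSpace X]
    (loc : FundamentalGroupoid X ⥤ SingleObj G) {x y : X} {γ δ : Path x y}
    (h : γ.Homotopic δ) : holonomy loc γ = holonomy loc δ := by
  rw [holonomy, holonomy, Path.Homotopic.Quotient.eq.2 h]

theorem holonomy_eq_of_forall_eq {G : Type*} [Group G] {X : Type*} [TopologicalSpace X]
    (loc : FundamentalGroupoid X ⥤ SingleObj G) {x y x' y' : X} (γ : Path x y) (δ : Path x' y')
    (h : ∀ s, γ s = δ s) : holonomy loc γ = holonomy loc δ := by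
  obtain rfl : x = x' := by simpa using h 0
  obtain rfl : y = y' := by simpa using h 1
  rw [show γ = δ from Path.ext (funext h)]

theorem seg_self (x : Triangle) (s : I) : seg x x s = x :=
  Subtype.ext (AffineMap.lineMap_same_apply _ _)

theorem seg_seg_right (x y : Triangle) (r s : I) :
    seg (seg x y r) y s = seg x y (unitInterval.symm (unitInterval.symm r * unitInterval.symm s)) := by
  apply Subtype.ext
  funext i
  simp only [seg_apply, unitInterval.coe_symm_eq, Set.Icc.coe_mul]
  ring

theorem continuous_seg_uncurry :
    Continuous fun p : Triangle × Triangle × I => seg p.1 p.2.1 p.2.2 := by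
  refine Continuous.subtype_mk ?_ _
  simp only [AffineMap.lineMap_apply_module]
  fun_prop

namespace IdealTriangulation

variable {S : Type*} [TopologicalSpace S] {M P : Set S} (T : IdealTriangulation M P)

/-- The characteristic map of a triangle, away from the punctures. -/
def chartCompl (t : T.Tri) : C({x : Triangle // T.chart t x ∉ P}, ↥Pᶜ) where
  toFun x := ⟨T.chart t x.1, x.2⟩
  continuous_toFun := ((T.continuous_chart t).comp continuous_subtype_val).subtype_mk _

/-- The straight path of a triangle from `x` to `y`, away from the punctures. -/
def segPath (t : T.Tri) (x y : {x : Triangle // T.chart t x ∉ P}) : Path x y where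
  toFun s := ⟨seg x.1 y.1 s, T.seg_notMem x.2 y.2 s⟩
  continuous_toFun := (continuous_seg _ _).subtype_mk _
  source' := Subtype.ext (seg_zero _ _)
  target' := Subtype.ext (seg_one _ _)

/-- A triangle without its corners at punctures is convex, so any two of its paths with the same
ends are homotopic. -/
theorem homotopic_of_triangle (t : T.Tri) {x y : {x : Triangle // T.chart t x ∉ P}}
    (γ δ : Path x y) : γ.Homotopic δ :=
  ⟨{ toFun := fun p => ⟨seg (γ p.2).1 (δ p.2).1 p.1, T.seg_notMem (γ p.2).2 (δ p.2).2 p.1⟩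
     continuous_toFun := by
      refine Continuous.subtype_mk ?_ _
      exact continuous_seg_uncurry.comp (f := fun p : I × I => ((γ p.2).1, (δ p.2).1, p.1))
        (by fun_prop)
     map_zero_left := fun s => Subtype.ext (seg_zero _ _)
     map_one_left := fun s => Subtype.ext (seg_one _ _)
     prop' := by
      rintro r s (rfl | rfl)
      · refine Subtype.ext ?_
        simp [seg_self]
      · refine Subtype.ext ?_
        simp [seg_self] }⟩

/-- In a triangle, straight segments between points near `x` stay near `x`. -/
theorem exists_nhds_seg_mem (t : T.Tri) (x : Triangle) {U : Set S} (hU : U ∈ 𝓝 (T.chart t x)) :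
    ∃ V ∈ 𝓝 x, ∀ y ∈ V, ∀ z ∈ V, ∀ r, T.chart t (seg y z r) ∈ U := by
  have hc : Continuous fun p : (Triangle × Triangle) × I => T.chart t (seg p.1.1 p.1.2 p.2) :=
    (T.continuous_chart t).comp (continuous_seg_uncurry.comp
      (f := fun p : (Triangle × Triangle) × I => (p.1.1, p.1.2, p.2)) (by fun_prop))
  have h : ∀ᶠ p in 𝓝 (x, x), ∀ r ∈ (Set.univ : Set I), T.chart t (seg p.1 p.2 r) ∈ U :=
    isCompact_univ.eventually_forall_of_forall_eventually
      (P := fun (p : Triangle × Triangle) r => T.chart t (seg p.1 p.2 r) ∈ U)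
      fun r _ => hc.continuousAt.eventually_mem (by simpa only [seg_self] using hU)
  rw [nhds_prod_eq] at h
  obtain ⟨V, hV, hVU⟩ := Filter.mem_prod_same_iff.1 h
  exact ⟨V, hV, fun y hy z hz r => hVU (Set.mk_mem_prod hy hz) r trivial⟩

theorem notMem_punctures (T : IdealTriangulation M P) {x : S} (hx : x ∈ M) : x ∉ P :=
  Set.disjoint_left.1 T.disjoint hx

/-- A point of a segment other than its start lies off the punctures if its end does. -/
theorem seg_notMem_of_pos {t : T.Tri} {x y : Triangle} (hy : T.chart t y ∉ P) {s : I}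
    (hs : 0 < s) : T.chart t (seg x y s) ∉ P := by
  intro h
  obtain ⟨i, hi⟩ := (T.mem_vertices_iff t _).1 (Or.inr h)
  suffices hy' : y = vtx i by exact hy (by rwa [hy', ← hi])
  rcases eq_or_ne s 1 with rfl | h1
  · rwa [seg_one] at hi
  rcases seg_eq_vtx hi with rfl | h'
  · have hs0 : (s : ℝ) ≠ 0 := fun h => hs.ne' (Subtype.ext h)
    apply Subtype.ext
    funext j
    have := congrArg (fun z : Triangle => z.1 j) hi
    simp only [seg_apply] at this
    apply mul_left_cancel₀ hs0
    linear_combination this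
  · exact h'

end IdealTriangulation

namespace FramedSystem

variable {k : Type*} [Field k] {S : Type*} [TopologicalSpace S] {M P : Set S}
  (L : FramedSystem k M P) (T : IdealTriangulation M P)

theorem transport_of_notMem {t : T.Tri} {x y : Triangle} (hx : T.chart t x ∉ P)
    (hy : T.chart t y ∉ P) : L.transport T t x y = L.hol (T.path t x y hx hy) :=
  dif_pos ⟨hx, hy⟩

theorem transport_mul {t : T.Tri} {x y z : Triangle} (hx : T.chart t x ∉ P)
    (hy : T.chart t y ∉ P) (hz : T.chart t z ∉ P) :
    L.transport T t y z * L.transport T t x y = L.transport T t x z := by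
  rw [L.transport_of_notMem T hx hy, L.transport_of_notMem T hy hz, L.transport_of_notMem T hx hz,
    hol, hol, hol, ← holonomy_trans]
  apply holonomy_congr
  have h := (T.homotopic_of_triangle t
    ((T.segPath t ⟨x, hx⟩ ⟨y, hy⟩).trans (T.segPath t ⟨y, hy⟩ ⟨z, hz⟩))
    (T.segPath t ⟨x, hx⟩ ⟨z, hz⟩)).map (T.chartCompl t)
  rw [Path.map_trans] at h
  exact h

theorem transport_self (t : T.Tri) (x : Triangle) : L.transport T t x x = 1 := by
  by_cases hx : T.chart t x ∈ P
  · exact dif_neg fun h => h.1 hx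
  · have h := L.transport_mul T hx hx hx
    exact mul_eq_left.1 h

/-- Transport depends only on the image of the segment in the surface, not on the triangle that
contains it. -/
theorem transport_congr {t t' : T.Tri} {x y x' y' : Triangle}
    (h : ∀ s, T.chart t (seg x y s) = T.chart t' (seg x' y' s)) :
    L.transport T t x y = L.transport T t' x' y' := by
  have h0 : T.chart t x = T.chart t' x' := by simpa only [seg_zero] using h 0
  have h1 : T.chart t y = T.chart t' y' := by simpa only [seg_one] using h 1
  by_cases hxy : T.chart t x ∉ P ∧ T.chart t y ∉ P
  · have hx' := h0 ▸ hxy.1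
    have hy' := h1 ▸ hxy.2
    rw [L.transport_of_notMem T hxy.1 hxy.2, L.transport_of_notMem T hx' hy']
    exact holonomy_eq_of_forall_eq _ _ _ fun s => Subtype.ext (h s)
  · rw [transport, transport, dif_neg hxy, dif_neg (by rwa [h0, h1] at hxy)]

/-! ### The distinguished points of the vertices -/

theorem decAt_eq_smul {c : T.Side} (h : T.src c ∈ M) {y y' : Triangle}
    (hy : T.chart c.1 y ∉ P) (hy' : T.chart c.1 y' ∉ P) :
    L.decAt T c h y' = L.transport T c.1 y y' • L.decAt T c h y := by
  rw [decAt, decAt, smul_smul, L.transport_mul T (T.notMem_punctures h) hy hy']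

theorem decAt_self {c : T.Side} (h : T.src c ∈ M) :
    L.decAt T c h (vtx c.2) = L.decoration ⟨T.src c, h⟩ := by
  rw [decAt, transport_self, one_smul]

theorem decAt_congr {c c' : T.Side} (h : T.src c ∈ M) (h' : T.src c' ∈ M) {y y' : Triangle}
    (hs : ∀ s, T.chart c.1 (seg (vtx c.2) y s) = T.chart c'.1 (seg (vtx c'.2) y' s)) :
    L.decAt T c h y = L.decAt T c' h' y' := by
  have h0 : T.src c = T.src c' := by simpa only [seg_zero] using! hs 0
  rw [decAt, decAt, L.transport_congr T hs]
  congr 2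
  exact Subtype.ext h0

/-- Inside a triangle, near a corner at a puncture, the framing is flat for the transport of the
triangle. -/
theorem exists_nhds_framing_eq {c : T.Side} (h : T.src c ∈ P) :
    ∃ V ∈ 𝓝 (vtx c.2), ∀ y ∈ V, ∀ z ∈ V, ∀ (hy : T.chart c.1 y ∉ P) (hz : T.chart c.1 z ∉ P),
      L.framing ⟨T.src c, h⟩ ⟨_, hz⟩ =
        L.transport T c.1 y z • L.framing ⟨T.src c, h⟩ ⟨_, hy⟩ := by
  obtain ⟨U, hU, hflat⟩ := L.framing_flat ⟨T.src c, h⟩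
  obtain ⟨V, hV, hVU⟩ := T.exists_nhds_seg_mem c.1 (vtx c.2) hU
  refine ⟨V, hV, fun y hyV z hzV hy hz => ?_⟩
  rw [L.transport_of_notMem T hy hz]
  exact hflat _ _ _ (hVU y hyV z hzV)

theorem eventually_seg_mem {x : Triangle} (y : Triangle) {V : Set Triangle} (hV : V ∈ 𝓝 x) :
    ∀ᶠ s in 𝓝[>] (0 : I), seg x y s ∈ V :=
  Filter.Eventually.filter_mono nhdsWithin_le_nhds
    ((continuous_seg x y).continuousAt.eventually_mem (by rwa [seg_zero]))

theorem nhdsGT_zero_neBot : (𝓝[>] (0 : I)).NeBot := nhdsGT_neBot_of_exists_gt ⟨1, one_pos⟩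

/-- The defining property of the transported framing: the transports to `y` of the values of the
framing near the corner have a common value. -/
theorem eventually_framingAt {c : T.Side} (h : T.src c ∈ P) {y : Triangle}
    (hy : T.chart c.1 y ∉ P) :
    ∀ᶠ s in 𝓝[>] (0 : I), ∃ hs : T.chart c.1 (seg (vtx c.2) y s) ∉ P,
      L.transport T c.1 (seg (vtx c.2) y s) y • L.framing ⟨T.src c, h⟩ ⟨_, hs⟩ =
        L.framingAt T c h y := by
  have := nhdsGT_zero_neBot
  obtain ⟨V, hV, hVL⟩ := L.exists_nhds_framing_eq T h
  have hev : ∀ᶠ s in 𝓝[>] (0 : I), seg (vtx c.2) y s ∈ V ∧ T.chart c.1 (seg (vtx c.2) y s) ∉ P :=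
    (eventually_seg_mem y hV).and
      (eventually_mem_nhdsWithin.mono fun s hs => T.seg_notMem_of_pos hy hs)
  obtain ⟨s₀, h₀V, h₀⟩ := hev.exists
  refine Classical.epsilon_spec (p := fun l => ∀ᶠ s in 𝓝[>] (0 : I),
    ∃ hs : T.chart c.1 (seg (vtx c.2) y s) ∉ P,
      L.transport T c.1 (seg (vtx c.2) y s) y • L.framing ⟨T.src c, h⟩ ⟨_, hs⟩ = l)
    ⟨L.transport T c.1 (seg (vtx c.2) y s₀) y • L.framing ⟨T.src c, h⟩ ⟨_, h₀⟩, ?_⟩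
  filter_upwards [hev] with s ⟨hsV, hs⟩
  refine ⟨hs, ?_⟩
  rw [hVL _ hsV _ h₀V hs h₀, smul_smul, L.transport_mul T hs h₀ hy]

theorem framingAt_eq_smul {c : T.Side} (h : T.src c ∈ P) {y y' : Triangle}
    (hy : T.chart c.1 y ∉ P) (hy' : T.chart c.1 y' ∉ P) :
    L.framingAt T c h y' = L.transport T c.1 y y' • L.framingAt T c h y := by
  have := nhdsGT_zero_neBot
  obtain ⟨V, hV, hVL⟩ := L.exists_nhds_framing_eq T h
  obtain ⟨s, ⟨⟨hsV, hsV'⟩, hs, e⟩, hs', e'⟩ := ((((eventually_seg_mem y hV).and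
    (eventually_seg_mem y' hV)).and (L.eventually_framingAt T h hy)).and
      (L.eventually_framingAt T h hy')).exists
  rw [← e, ← e', hVL _ hsV _ hsV' hs hs', smul_smul, smul_smul, L.transport_mul T hs hs' hy',
    L.transport_mul T hs hy hy']

theorem framingAt_congr {c c' : T.Side} (h : T.src c ∈ P) (h' : T.src c' ∈ P) {y y' : Triangle}
    (hs : ∀ s, T.chart c.1 (seg (vtx c.2) y s) = T.chart c'.1 (seg (vtx c'.2) y' s)) :
    L.framingAt T c h y = L.framingAt T c' h' y' := by
  have h0 : (⟨T.src c, h⟩ : P) = ⟨T.src c', h'⟩ :=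
    Subtype.ext (by simpa only [seg_zero] using! hs 0)
  rw [framingAt, framingAt, h0]
  congr 1
  funext l
  refine propext (Filter.eventually_congr (.of_forall fun s => ?_))
  have htr : L.transport T c.1 (seg (vtx c.2) y s) y = L.transport T c'.1 (seg (vtx c'.2) y' s) y' :=
    L.transport_congr T fun r => by rw [seg_seg_right, seg_seg_right, hs]
  simp only [hs s, htr]

/-- Transport of distinguished points inside a triangle. -/
theorem lineAt_eq_smul (c : T.Side) {y y' : Triangle}
    (hy : T.chart c.1 y ∉ P) (hy' : T.chart c.1 y' ∉ P) :
    L.lineAt T c y' = L.transport T c.1 y y' • L.lineAt T c y := by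
  by_cases h : T.src c ∈ M
  · rw [lineAt, lineAt, dif_pos h, dif_pos h, L.decAt_eq_smul T h hy hy', DecFlag.line_smul]
  · rw [lineAt, lineAt, dif_neg h, dif_neg h, L.framingAt_eq_smul T _ hy hy']

/-- The distinguished point depends only on the image of the segment in the surface, not on the
triangle that contains it. -/
theorem lineAt_congr {c c' : T.Side} {y y' : Triangle}
    (hs : ∀ s, T.chart c.1 (seg (vtx c.2) y s) = T.chart c'.1 (seg (vtx c'.2) y' s)) :
    L.lineAt T c y = L.lineAt T c' y' := by
  have h0 : T.src c = T.src c' := by simpa only [seg_zero] using! hs 0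
  by_cases h : T.src c ∈ M
  · have h' : T.src c' ∈ M := h0 ▸ h
    rw [lineAt, lineAt, dif_pos h, dif_pos h', L.decAt_congr T h h' hs]
  · have h' : T.src c' ∉ M := h0 ▸ h
    rw [lineAt, lineAt, dif_neg h, dif_neg h', L.framingAt_congr T _ _ hs]

theorem lineAt_of_mem {c : T.Side} (h : T.src c ∈ M) (y : Triangle) :
    L.lineAt T c y = (L.decAt T c h y).line := dif_pos h

end FramedSystem

/-! ### Coordinates in the fibre over a corner -/

theorem seg_symm (x y : Triangle) (s : I) : seg x y (unitInterval.symm s) = seg y x s := by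
  apply Subtype.ext
  funext i
  simp only [seg_apply, unitInterval.coe_symm_eq]
  ring

theorem seg_seg_left (x y : Triangle) (r s : I) : seg x (seg x y r) s = seg x y (s * r) := by
  apply Subtype.ext
  funext i
  simp only [seg_apply, Set.Icc.coe_mul]
  ring

namespace IdealTriangulation

variable {S : Type*} [TopologicalSpace S] {M P : Set S} (T : IdealTriangulation M P)

theorem chart_glue {c : T.Side} (h : T.glue c ≠ c) (s : I) :
    T.chart c.1 (seg (vtx c.2) (vtx (c.2 + 1)) s) =
      T.chart (T.glue c).1 (seg (vtx ((T.glue c).2 + 1)) (vtx (T.glue c).2) s) :=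
  (T.chart_eq_iff ⟨_, _⟩ ⟨_, _⟩).2 (Relation.EqvGen.rel _ _ ⟨c, s, h, rfl, rfl⟩)

theorem mid_eq_seg_symm (c : T.Side) :
    T.mid c = seg (vtx (c.2 + 1)) (vtx c.2) ⟨1 / 2, by norm_num, by norm_num⟩ := by
  rw [mid, ← seg_symm]
  congr 1
  apply Subtype.ext
  simp only [unitInterval.coe_symm_eq]
  norm_num

theorem mid_notMem {c : T.Side} (h : T.src c ∉ P) : T.chart c.1 (T.mid c) ∉ P := by
  rw [mid_eq_seg_symm]
  exact T.seg_notMem_of_pos h (Subtype.coe_lt_coe.1 (by norm_num))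

theorem chart_seg_mid {c : T.Side} (h : T.glue c ≠ c) (s : I) :
    T.chart c.1 (seg (vtx c.2) (T.mid c) s) =
      T.chart (T.glue c).1 (seg (vtx ((T.glue c).2 + 1)) (T.mid (T.glue c)) s) := by
  rw [mid_eq_seg_symm T (T.glue c), mid, seg_seg_left, seg_seg_left, T.chart_glue h]

theorem prevSide_prevSide (c : T.Side) : T.prevSide (T.prevSide c) = T.nextSide c := by
  simp only [prevSide, nextSide, add_assoc]
  rfl

theorem nextSide_prevSide (c : T.Side) : T.nextSide (T.prevSide c) = c := by
  simp only [prevSide, nextSide, add_assoc]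
  exact Prod.ext rfl (add_zero c.2)

theorem prevSide_snd_add_one (c : T.Side) : (T.prevSide c).2 + 1 = c.2 :=
  congrArg Prod.snd (T.nextSide_prevSide c)

end IdealTriangulation

namespace FramedSystem

variable {k : Type*} [Field k] {S : Type*} [TopologicalSpace S] {M P : Set S}
  (L : FramedSystem k M P) (T : IdealTriangulation M P)

theorem lineAt_glue {c : T.Side} (h : T.glue c ≠ c) :
    L.lineAt T c (vtx (c.2 + 1)) = L.lineAt T (T.nextSide (T.glue c)) (vtx (T.glue c).2) :=
  L.lineAt_congr T (T.chart_glue h)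

theorem lineAt_vtx {c : T.Side} {v : M} (h : T.src c = v) :
    L.lineAt T c (vtx c.2) = (L.decoration v).line := by
  have hM : T.src c ∈ M := h ▸ v.2
  rw [L.lineAt_of_mem T hM, decAt_self]
  congr 2
  exact Subtype.ext h

/-- The quadrilateral of an internal edge in the fibre over the start of the edge. -/
theorem quadX_eq_smul {c : T.Side} (hc : T.glue c ≠ c) (h : T.src c ∉ P) (i : Fin 4) :
    L.quadX T c i = L.transport T c.1 (vtx c.2) (T.mid c) •
      ![L.lineAt T c (vtx c.2), L.lineAt T (T.prevSide (T.glue c)) (vtx ((T.glue c).2 + 1)),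
        L.lineAt T (T.nextSide c) (vtx c.2), L.lineAt T (T.prevSide c) (vtx c.2)] i := by
  have hm := T.mid_notMem h
  have hs := T.chart_seg_mid hc
  fin_cases i
  · exact L.lineAt_eq_smul T c h hm
  · rw [L.transport_congr T hs]
    have h0 := hs 0
    have h1 := hs 1
    rw [seg_zero, seg_zero] at h0
    rw [seg_one, seg_one] at h1
    exact L.lineAt_eq_smul T (T.prevSide (T.glue c)) (h0 ▸ h) (h1 ▸ hm)
  · exact L.lineAt_eq_smul T (T.nextSide c) h hm
  · exact L.lineAt_eq_smul T (T.prevSide c) h hm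

theorem X_eq {c : T.Side} (hc : T.glue c ≠ c) (h : T.src c ∉ P) :
    L.X T c = crossRatio (L.lineAt T c (vtx c.2))
      (L.lineAt T (T.prevSide (T.glue c)) (vtx ((T.glue c).2 + 1)))
      (L.lineAt T (T.nextSide c) (vtx c.2)) (L.lineAt T (T.prevSide c) (vtx c.2)) := by
  simp only [X, L.quadX_eq_smul T hc h, crossRatio_smul]
  rfl

theorem XDefined_iff {c : T.Side} (hc : T.glue c ≠ c) (h : T.src c ∉ P) :
    L.XDefined T c ↔ CrossRatioDefined (L.lineAt T c (vtx c.2))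
      (L.lineAt T (T.prevSide (T.glue c)) (vtx ((T.glue c).2 + 1)))
      (L.lineAt T (T.nextSide c) (vtx c.2)) (L.lineAt T (T.prevSide c) (vtx c.2)) := by
  simp only [XDefined, L.quadX_eq_smul T hc h, crossRatioDefined_smul]
  rfl

section External

variable (F : T.External) {y : Triangle} (hy : T.chart F.1.1 y ∉ P)
include hy

theorem decSrc_eq_smul : L.decSrc T F =
    L.transport T F.1.1 y (T.mid F.1) • L.decAt T F.1 (T.src_mem F) y :=
  L.decAt_eq_smul T (T.src_mem F) hy (T.mid_notMem (T.notMem_punctures (T.src_mem F)))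

theorem decTgt_eq_smul : L.decTgt T F =
    L.transport T F.1.1 y (T.mid F.1) • L.decAt T (T.nextSide F.1) (T.tgt_mem F) y :=
  L.decAt_eq_smul T (c := T.nextSide F.1) (T.tgt_mem F) hy
    (T.mid_notMem (T.notMem_punctures (T.src_mem F)))

/-- The four lines of a boundary coordinate, in any other fibre over the triangle. -/
theorem quadB_eq_smul (i : Fin 4) :
    L.quadB T F i = L.transport T F.1.1 y (T.mid F.1) •
      ![(L.decAt T F.1 (T.src_mem F) y).line,
        (L.decAt T F.1 (T.src_mem F) y).pinning (L.decAt T (T.nextSide F.1) (T.tgt_mem F) y),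
        (L.decAt T (T.nextSide F.1) (T.tgt_mem F) y).line,
        L.lineAt T (T.prevSide F.1) y] i := by
  rw [quadB, L.decSrc_eq_smul T F hy, L.decTgt_eq_smul T F hy]
  fin_cases i
  · exact DecFlag.line_smul _ _
  · exact DecFlag.pinning_smul _ _ _
  · exact DecFlag.line_smul _ _
  · exact L.lineAt_eq_smul T (T.prevSide F.1) hy
      (T.mid_notMem (T.notMem_punctures (T.src_mem F)))

theorem B_eq : L.B T F = crossRatio (L.decAt T F.1 (T.src_mem F) y).line
    ((L.decAt T F.1 (T.src_mem F) y).pinning (L.decAt T (T.nextSide F.1) (T.tgt_mem F) y))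
    (L.decAt T (T.nextSide F.1) (T.tgt_mem F) y).line (L.lineAt T (T.prevSide F.1) y) := by
  simp only [B, L.quadB_eq_smul T F hy, crossRatio_smul]
  rfl

theorem BDefined.line_ne (h : L.BDefined T F) :
    (L.decAt T F.1 (T.src_mem F) y).line ≠ L.lineAt T (T.prevSide F.1) y := by
  simp only [BDefined, L.quadB_eq_smul T F hy, crossRatioDefined_smul] at h
  exact h.2

theorem K_eq : L.K T F = ((L.decAt T F.1 (T.src_mem F) y).Delta
    (L.decAt T (T.nextSide F.1) (T.tgt_mem F) y))⁻¹ := by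
  rw [K, L.decSrc_eq_smul T F hy, L.decTgt_eq_smul T F hy, DecFlag.Delta_smul]

theorem IsGeneric.line_ne (h : L.IsGeneric T) : (L.decAt T F.1 (T.src_mem F) y).line ≠
    (L.decAt T (T.nextSide F.1) (T.tgt_mem F) y).line := by
  have := h F
  rwa [L.decSrc_eq_smul T F hy, L.decTgt_eq_smul T F hy, DecFlag.line_smul, DecFlag.line_smul,
    (MulAction.injective _).ne_iff] at this

end External

end FramedSystem

/-! ### Telescoping along the edges at a marked point -/

section Telescoping

variable {k : Type*} [Field k] (a : DecFlag k) (x : ℕ → ℙ k (Fin 2 → k)) {n : ℕ} (X : Fin n → k)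
  (hX : ∀ j : Fin n, X j = crossRatio a.line (x j) (x (j + 1)) (x (j + 2)))
  (hx : ∀ j ≤ n + 1, a.line ≠ x j)
include hX hx

/-- Partial products of the coordinates: each factor moves the potential to the next pair of
consecutive lines. -/
theorem potential_mul_prod (hne : ∀ j < n, x j ≠ x (j + 1)) {m : ℕ} (hm : m ≤ n) :
    a.potential (x 0) (x 1) * ∏ i ∈ Finset.univ.filter (fun i : Fin n => (i : ℕ) < m), X i =
      a.potential (x m) (x (m + 1)) := by
  induction m with
  | zero => simp
  | succ m ih =>
    have hins : Finset.univ.filter (fun i : Fin n => (i : ℕ) < m + 1) =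
        insert ⟨m, hm⟩ (Finset.univ.filter fun i : Fin n => (i : ℕ) < m) := by
      ext i
      simp [Fin.ext_iff]
      omega
    rw [hins, Finset.prod_insert (by simp), mul_left_comm, ih (by omega), hX, mul_comm]
    exact a.potential_mul_crossRatio _ _ _ (hx _ (by omega)) (hne _ (by omega))

/-- The sum of the partial products telescopes, by additivity of the potential. -/
theorem sum_potential_mul_prod (hne : ∀ j < n, x j ≠ x (j + 1)) {m : ℕ} (hm : m ≤ n) :
    ∑ j ∈ Finset.range (m + 1), a.potential (x 0) (x 1) *
        ∏ i ∈ Finset.univ.filter (fun i : Fin n => (i : ℕ) < j), X i =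
      a.potential (x 0) (x (m + 1)) := by
  induction m with
  | zero => simp
  | succ m ih =>
    rw [Finset.sum_range_succ, ih (by omega), potential_mul_prod a x X hX hx hne hm]
    exact a.potential_add_potential _ _ _ (hx _ (by omega)) (hx _ (by omega)) (hx _ (by omega))

end Telescoping

namespace FramedSystem

variable {k : Type*} [Field k] {S : Type*} [TopologicalSpace S] {M P : Set S}
  (L : FramedSystem k M P) {T : IdealTriangulation M P} {v : S} (f : T.Fan v)

/-- The distinguished points of the far ends of the successive edges `F, E_1, …, E_k, F⁺` at a
marked point, numbered by `0, …, k + 1` and transported to this marked point along the edges.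
All larger indices give the point of `F⁺`. -/
noncomputable def farLine (n : ℕ) : ℙ k (Fin 2 → k) :=
  if h : n < f.k + 1 then L.lineAt T (T.nextSide (f.corner ⟨n, h⟩)) (vtx (f.corner ⟨n, h⟩).2)
  else L.lineAt T (T.prevSide (f.corner (Fin.last f.k))) (vtx (f.corner (Fin.last f.k)).2)

theorem lineAt_nextSide_corner (j : Fin (f.k + 1)) :
    L.lineAt T (T.nextSide (f.corner j)) (vtx (f.corner j).2) = L.farLine f j := by
  rw [farLine, dif_pos j.2]

/-- The last side of a corner and, across it, the first side of the next corner give the same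
distinguished point at the marked point. -/
theorem lineAt_prevSide_corner (j : Fin (f.k + 1)) :
    L.lineAt T (T.prevSide (f.corner j)) (vtx (f.corner j).2) = L.farLine f (j + 1) := by
  induction j using Fin.lastCases with
  | last => rw [farLine, dif_neg (by simp)]
  | cast j =>
    have h := L.lineAt_glue T (f.internal j)
    rw [T.prevSide_snd_add_one, ← f.succ j, L.lineAt_nextSide_corner f] at h
    exact h

theorem glue_E (j : Fin f.k) : T.glue (f.E j) = T.prevSide (f.corner j.castSucc) := by
  rw [IdealTriangulation.Fan.E, f.succ, T.glue_involutive]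

theorem glue_E_ne (j : Fin f.k) : T.glue (f.E j) ≠ f.E j := by
  rw [glue_E, IdealTriangulation.Fan.E, f.succ]
  exact (f.internal j).symm

theorem X_E (v : M) (f : T.Fan (v : S)) (j : Fin f.k) : L.X T (f.E j) =
    crossRatio (L.decoration v).line (L.farLine f j) (L.farLine f (j + 1)) (L.farLine f (j + 2)) := by
  have hv : T.src (f.E j) ∉ P := by
    rw [f.src_E j]
    exact T.notMem_punctures v.2
  have h2 := L.lineAt_nextSide_corner f j.succ
  have h3 := L.lineAt_prevSide_corner f j.succ
  rw [L.X_eq T (glue_E_ne f j) hv, L.lineAt_vtx T (f.src_E j), glue_E, T.prevSide_prevSide,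
    T.prevSide_snd_add_one, L.lineAt_nextSide_corner f]
  exact congrArg₂ _ h2 h3

theorem XDefined_E_iff (v : M) (f : T.Fan (v : S)) (j : Fin f.k) : L.XDefined T (f.E j) ↔
    L.farLine f j ≠ L.farLine f (j + 1) ∧ (L.decoration v).line ≠ L.farLine f (j + 2) := by
  have hv : T.src (f.E j) ∉ P := by
    rw [f.src_E j]
    exact T.notMem_punctures v.2
  have h2 := L.lineAt_nextSide_corner f j.succ
  have h3 := L.lineAt_prevSide_corner f j.succ
  rw [L.XDefined_iff T (glue_E_ne f j) hv, L.lineAt_vtx T (f.src_E j), glue_E, T.prevSide_prevSide,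
    T.prevSide_snd_add_one, L.lineAt_nextSide_corner f]
  unfold CrossRatioDefined
  rw [← Fin.val_succ, ← h2, ← show _ = L.farLine f (j + 2) from h3]
  rfl

end FramedSystem

end DecSurf

theorem theorem2p2 {S : Type*} [TopologicalSpace S] {M P : Set S}
    (T : DecSurf.IdealTriangulation M P) {k : Type*} [Field k]
    (L : DecSurf.FramedSystem k M P) (hL : L.IsGeneric T)
    (v : M) (f : T.Fan (v : S))
    (hF : L.BDefined T f.F) (hE : ∀ j, L.XDefined T (f.E j)) :
    (L.BDefined T f.Fplus →
      L.K T f.Fplus = L.B T f.F * (∏ j, L.X T (f.E j)) * L.B T f.Fplus) ∧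
    L.W T v f.F f.Fplus f.src_F f.tgt_Fplus =
      ∑ j ∈ Finset.range (f.k + 1),
        L.B T f.F * ∏ i ∈ Finset.univ.filter (fun i : Fin f.k => (i : ℕ) < j),
          L.X T (f.E i) := by
  have hv : (v : S) ∉ P := T.notMem_punctures v.2
  -- The four lines of `B_F`, in the fibre at `v`.
  have hyF : T.chart f.F.1.1 (DecSurf.vtx f.F.1.2) ∉ P := by
    rw [← f.src_F] at hv; exact hv
  have haF : L.decAt T f.F.1 (T.src_mem f.F) (DecSurf.vtx f.F.1.2) = L.decoration v := by
    rw [L.decAt_self]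
    exact congrArg _ (Subtype.ext f.src_F)
  have hbF : (L.decAt T (T.nextSide f.F.1) (T.tgt_mem f.F) (DecSurf.vtx f.F.1.2)).line =
      L.farLine f 0 := by
    rw [← L.lineAt_of_mem T (c := T.nextSide f.F.1) (T.tgt_mem f.F)]
    exact L.lineAt_nextSide_corner f 0
  have hzF : L.lineAt T (T.prevSide f.F.1) (DecSurf.vtx f.F.1.2) = L.farLine f 1 :=
    L.lineAt_prevSide_corner f 0
  -- The four lines of `B_{F⁺}`, in the fibre at `v`.
  have hend : f.Fplus.1.2 + 1 = (f.corner (Fin.last f.k)).2 := T.prevSide_snd_add_one _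
  have hyG : T.chart f.Fplus.1.1 (DecSurf.vtx (f.Fplus.1.2 + 1)) ∉ P := by
    rw [← f.tgt_Fplus] at hv; exact hv
  have haG : L.decAt T (T.nextSide f.Fplus.1) (T.tgt_mem f.Fplus) (DecSurf.vtx (f.Fplus.1.2 + 1)) =
      L.decoration v := by
    refine (L.decAt_self T (c := T.nextSide f.Fplus.1) (T.tgt_mem f.Fplus)).trans ?_
    exact congrArg _ (Subtype.ext f.tgt_Fplus)
  have hbG : (L.decAt T f.Fplus.1 (T.src_mem f.Fplus) (DecSurf.vtx (f.Fplus.1.2 + 1))).line =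
      L.farLine f (f.k + 1) := by
    rw [← L.lineAt_of_mem T, hend]
    exact L.lineAt_prevSide_corner f (Fin.last f.k)
  have hzG : L.lineAt T (T.prevSide f.Fplus.1) (DecSurf.vtx (f.Fplus.1.2 + 1)) = L.farLine f f.k := by
    rw [hend]
    refine (congrArg (L.lineAt T · _) (T.prevSide_prevSide _)).trans ?_
    exact L.lineAt_nextSide_corner f (Fin.last f.k)
  -- Genericity and the definedness of the coordinates keep all far ends off the line at `v`.
  have h0 : (L.decoration v).line ≠ L.farLine f 0 := by
    have := DecSurf.FramedSystem.IsGeneric.line_ne L T f.F hyF hL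
    rwa [haF, hbF] at this
  have h1 : (L.decoration v).line ≠ L.farLine f 1 := by
    have := DecSurf.FramedSystem.BDefined.line_ne L T f.F hyF hF
    rwa [haF, hzF] at this
  have hx : ∀ j ≤ f.k + 1, (L.decoration v).line ≠ L.farLine f j := by
    intro j hj
    match j with
    | 0 => exact h0
    | 1 => exact h1
    | j + 2 => exact ((L.XDefined_E_iff v f ⟨j, by omega⟩).1 (hE _)).2
  have hne : ∀ j < f.k, L.farLine f j ≠ L.farLine f (j + 1) := fun j hj =>
    ((L.XDefined_E_iff v f ⟨j, hj⟩).1 (hE _)).1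
  have hB : L.B T f.F = (L.decoration v).potential (L.farLine f 0) (L.farLine f 1) := by
    rw [L.B_eq T f.F hyF, haF, hzF, ← hbF]
    exact DecSurf.DecFlag.crossRatio_pinning_eq_potential _ _ _ (hbF ▸ h0) h1
  constructor
  · intro hG
    have hprod := DecSurf.potential_mul_prod _ _ _ (L.X_E v f) hx hne le_rfl
    rw [Finset.filter_true_of_mem fun i _ => i.2, ← hB] at hprod
    have hG' := DecSurf.FramedSystem.BDefined.line_ne L T f.Fplus hyG hG
    rw [hprod, L.B_eq T f.Fplus hyG, L.K_eq T f.Fplus hyG, haG, hzG, ← hbG]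
    rw [hzG] at hG'
    exact (DecSurf.DecFlag.potential_mul_crossRatio_pinning _ _ _ (hbG ▸ hx _ le_rfl)
      (hx _ (by omega)) hG').symm
  · rw [hB, DecSurf.sum_potential_mul_prod _ _ _ (L.X_E v f) hx hne le_rfl, ← hbF, ← hbG]
    rfl
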